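/- Let $0\le w\le n$ be integers and let $\{0,1\}^n_w$ be the set of binary words of length $n$ and Hamming weight $w$. For $x\in\{0,1\}^n_w$ let $\lambda_x(1)<\dots<\lambda_x(w)$ be the positions (in $\{1,\dots,n\}$) of the $1$'s of $x$, and put $\operatorname{rank}(x)=\sum_{i=1}^{w}(\lambda_x(i)-i)$. Write $x\rightsquigarrow y$ if $\lambda_x(i)\le\lambda_y(i)$ for all $i=1,\dots,w$ (each $1$ may only be shifted to the right). A code $C\subseteq\{0,1\}^n_w$ *detects up to $t$ right-shifts* if for all $x,y\in C$ with $x\rightsquigarrow y$ and $x\ne y$ one has $|\operatorname{rank}(x)-\operatorname{rank}(y)|>t$; it *detects all patterns of right-shifts* if $x,y\in C$ and $x\rightsquigarrow y$ imply $x=y$. Let $p(N,M,\ell)$ be the number of partitions of the integer $\ell$ into at most $M$ positive parts, each part being at most $N$. 1. For every integer $t\ge 0$, the maximum cardinality of a code $C\subseteq\{0,1\}^n_w$ detecting up to $t$ right-shifts is at least $$\sum_{\substack{0\le \ell\le w(n-w)\\ \ell\equiv\lfloor w(n-w)/2\rfloor\ (\mathrm{mod}\ t+1)}} p(n-w,w,\ell).$$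 2. The maximum cardinality of a code $C\subseteq\{0,1\}^n_w$ detecting all patterns of right-shifts is exactly $$p\bigl(n-w,\,w,\,\lfloor w(n-w)/2\rfloor\bigr).$$ -/

import Mathlib

namespace AsymmetricChannel

/-- A code `C` detects up to `t` errors in the channel `K` on `X` (a relation, where `K x y` means
that the input `x` can produce the output `y`) whose poset has the rank function `ρ`. -/
def DetectsUpTo {X : Type*} (K : X → X → Prop) (ρ : X → ℕ) (t : ℕ) (C : Finset X) : Prop :=
  ∀ x ∈ C, ∀ y ∈ C, K x y → x ≠ y → (t : ℤ) < |(ρ x : ℤ) - (ρ y : ℤ)|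

/-- A code `C` detects all error patterns in the channel `K`. -/
def DetectsAll {X : Type*} (K : X → X → Prop) (C : Finset X) : Prop :=
  ∀ x ∈ C, ∀ y ∈ C, K x y → x = y

end AsymmetricChannel

namespace BitShift

/-- Binary words of length `n`; `true` stands for `1` and `false` for `0`. -/
abbrev Word (n : ℕ) : Type := Fin n → Bool

/-- The (zero-based) positions of the ones in `x`. -/
def ones {n : ℕ} (x : Word n) : Finset (Fin n) := Finset.univ.filter fun i => x i = true

/-- The Hamming weight. -/
def weight {n : ℕ} (x : Word n) : ℕ := (ones x).card

/-- `lam x i` is the position in `{1, …, n}` of the one of `x` with index `i`, where the ones are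
listed from left to right and indexed by `0, …, weight x - 1`. -/
def lam {n : ℕ} (x : Word n) (i : Fin (weight x)) : ℕ :=
  ((ones x).orderEmbOfFin (k := weight x) rfl i : ℕ) + 1

/-- The sequence `lam x - (1, 2, …, w)`; the subtraction never truncates, see
`lamTilde_add`. -/
def lamTilde {n : ℕ} (x : Word n) (i : Fin (weight x)) : ℕ :=
  lam x i - ((i : ℕ) + 1)

theorem lamTilde_add {n : ℕ} (x : Word n) (i : Fin (weight x)) :
    lamTilde x i + ((i : ℕ) + 1) = lam x i := by
  have key : ∀ (k : ℕ) (hk : k < weight x), k ≤ ((ones x).orderEmbOfFin (k := weight x) rfl ⟨k, hk⟩ : ℕ) := by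
    intro k
    induction k with
    | zero => intro _; exact Nat.zero_le _
    | succ k ih =>
      intro hk
      have h1 := ih (Nat.lt_of_succ_lt hk)
      have h2 : (ones x).orderEmbOfFin (k := weight x) rfl ⟨k, Nat.lt_of_succ_lt hk⟩
          < (ones x).orderEmbOfFin (k := weight x) rfl ⟨k + 1, hk⟩ :=
        ((ones x).orderEmbOfFin (k := weight x) rfl).strictMono (Nat.lt_succ_self k)
      exact Nat.succ_le_of_lt (lt_of_le_of_lt h1 h2)
  have h : (i : ℕ) ≤ ((ones x).orderEmbOfFin (k := weight x) rfl i : ℕ) := key i i.2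
  unfold lamTilde lam
  omega

/-- The right-shift channel: `x` can produce `y` iff the two words have the same Hamming weight
and every one of `y` is weakly to the right of the corresponding one of `x`. -/
def RightShift {n : ℕ} (x y : Word n) : Prop :=
  ∃ h : weight x = weight y, ∀ i : Fin (weight x), lam x i ≤ lam y (Fin.cast h i)

/-- The rank function of the poset of the right-shift channel. -/
def rank {n : ℕ} (x : Word n) : ℕ := ∑ i : Fin (weight x), lamTilde x i

/-- The number of partitions of `l` into at most `M` positive parts, each part at most `N`. -/
def p (N M l : ℕ) : ℕ :=
  (Finset.univ.filter fun q : Nat.Partition l =>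
    q.parts.card ≤ M ∧ ∀ a ∈ q.parts, a ≤ N).card

end BitShift

/-!
The upper bound in the second part says that a code detecting all right-shifts, which is an
antichain for the shift order on words of length `n` and weight `w`, is no larger than the middle
level; that is, the lattice `L(w, n - w)` of partitions in a box has the Sperner property.

It is proved with the representation of `sl₂` on the exterior power `Λ^w` of its irreducible
representation of dimension `n`. Moving a one from position `i` to `i + 1` (zero-based) is given
the weight `√((i + 1) (n - 1 - i))`. The resulting raising operator `shiftOp false` on real
functions on words has the adjoint `shiftOp true`, and their commutator is diagonal with eigenvalue
`w (n - w) - 2 rank x` at `x` (`shiftOp_commutator`). Hence the squared norms of `shiftOp false f`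
and `shiftOp true f` differ by a form that is definite on functions supported strictly below or
strictly above the middle rank (`norm_shiftOp`), so raising is injective below the middle and
lowering is injective above it. Therefore a set of words below the middle has at least as many
upper covers as elements, and dually above it (`exists_upper_covers`, `exists_lower_covers`).
Replacing again and again the extreme level of an antichain by its covers pushes the antichain into
the middle level without losing elements (`exists_antichain_ge`, `card_le_of_detectsAll`).

A level is itself an antichain, and the words of a given rank correspond to the partitions counted
by `p` (`card_level`). For the first part, the words whose rank lies in a fixed residue class modulo
`t + 1` form a code detecting up to `t` right-shifts.
-/

namespace BitShift

open Finset

/-! ### Words as increasing position sequences -/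

/-- The zero-based positions of the ones of a word of weight `w`, as an increasing sequence
indexed by `Fin w` rather than by the dependent type `Fin (weight x)`. -/
def pos {n w : ℕ} (x : Word n) (hx : weight x = w) : Fin w ↪o Fin n :=
  (ones x).orderEmbOfFin hx

theorem mem_ones {n : ℕ} {x : Word n} {k : Fin n} : k ∈ ones x ↔ x k = true := by
  simp [ones]

theorem lam_cast {n w : ℕ} (x : Word n) (hx : weight x = w) (i : Fin w) :
    lam x (Fin.cast hx.symm i) = (pos x hx i : ℕ) + 1 := by
  subst hx
  rfl

theorem lamTilde_cast {n w : ℕ} (x : Word n) (hx : weight x = w) (i : Fin w) :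
    lamTilde x (Fin.cast hx.symm i) + i = (pos x hx i : ℕ) := by
  have h1 := lamTilde_add x (Fin.cast hx.symm i)
  rw [lam_cast x hx] at h1
  simp only [Fin.val_cast] at h1
  omega

theorem rightShift_iff {n w : ℕ} {x y : Word n} (hx : weight x = w) (hy : weight y = w) :
    RightShift x y ↔ ∀ i, pos x hx i ≤ pos y hy i := by
  subst hx
  have key : ∀ (h : weight x = weight y) (i : Fin (weight x)),
      lam x i ≤ lam y (Fin.cast h i) ↔ pos x rfl i ≤ pos y hy i := by
    intro h i
    have h1 := lam_cast x rfl i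
    have h2 := lam_cast y hy i
    rw [Fin.cast_eq_self] at h1
    rw [h1, h2, Fin.le_def]
    omega
  exact ⟨fun ⟨h, H⟩ i => (key h i).1 (H i), fun H => ⟨hy.symm, fun i => (key hy.symm i).2 (H i)⟩⟩

theorem sum_pos {n w : ℕ} {x : Word n} (hx : weight x = w) :
    ∑ i, (pos x hx i : ℕ) = ∑ k ∈ ones x, (k : ℕ) := by
  rw [← Finset.map_orderEmbOfFin_univ (ones x) hx, Finset.sum_map]
  rfl

theorem rank_eq_sum {n w : ℕ} {x : Word n} (hx : weight x = w) :
    rank x = ∑ i : Fin w, lamTilde x (Fin.cast hx.symm i) := by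
  subst hx
  rfl

theorem rank_add {n w : ℕ} {x : Word n} (hx : weight x = w) :
    rank x + ∑ i : Fin w, (i : ℕ) = ∑ k ∈ ones x, (k : ℕ) := by
  rw [← sum_pos hx, rank_eq_sum hx, ← Finset.sum_add_distrib]
  exact Finset.sum_congr rfl fun i _ => lamTilde_cast x hx i

theorem two_mul_rank_add {n w : ℕ} {x : Word n} (hx : weight x = w) :
    2 * (rank x : ℝ) + w * (w - 1) = 2 * ∑ k ∈ ones x, (k : ℝ) := by
  have h1 : (rank x : ℝ) + ∑ i : Fin w, (i : ℝ) = ∑ k ∈ ones x, (k : ℝ) := by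
    exact_mod_cast rank_add hx
  have h2 : ∀ v : ℕ, 2 * ∑ i : Fin v, (i : ℝ) = v * (v - 1) := by
    intro v
    induction v with
    | zero => simp
    | succ v ih =>
      rw [Fin.sum_univ_castSucc, mul_add]
      simp only [Fin.val_castSucc, ih, Fin.val_last]
      push_cast
      ring
  rw [← h1, mul_add, h2]

theorem weight_le {n : ℕ} (x : Word n) : weight x ≤ n := by
  simpa [weight] using Finset.card_le_univ (ones x)

theorem ext_pos {n w : ℕ} {x y : Word n} (hx : weight x = w) (hy : weight y = w)
    (h : ∀ i, pos x hx i = pos y hy i) : x = y := by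
  have h1 : ones x = ones y := by
    rw [← Finset.map_orderEmbOfFin_univ (ones x) hx, ← Finset.map_orderEmbOfFin_univ (ones y) hy]
    exact congrArg (fun e => Finset.map e univ) (Function.Embedding.ext h)
  funext k
  rw [Bool.eq_iff_iff, ← mem_ones, ← mem_ones, h1]

theorem RightShift.trans {n : ℕ} {x y z : Word n} (h1 : RightShift x y) (h2 : RightShift y z) :
    RightShift x z := by
  obtain ⟨h, -⟩ := id h1
  obtain ⟨h', -⟩ := id h2
  rw [rightShift_iff h rfl] at h1
  rw [rightShift_iff rfl h'.symm] at h2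
  exact (rightShift_iff h h'.symm).2 fun i => (h1 i).trans (h2 i)

theorem RightShift.rank_lt {n : ℕ} {x y : Word n} (h1 : RightShift x y) (hne : x ≠ y) :
    rank x < rank y := by
  obtain ⟨h, -⟩ := id h1
  rw [rightShift_iff h rfl] at h1
  have h2 : ∑ i, (pos x h i : ℕ) < ∑ i, (pos y rfl i : ℕ) := by
    refine Finset.sum_lt_sum (fun i _ => h1 i) ?_
    by_contra! hcon
    exact hne (ext_pos h rfl fun i => le_antisymm (h1 i) (hcon i (mem_univ i)))
  rw [sum_pos, sum_pos, ← rank_add h, ← rank_add (rfl : weight y = _)] at h2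
  omega

/-! ### Elementary shifts -/

/-- The word obtained by exchanging the letters at the adjacent positions `i` and `i + 1`. -/
def move {m : ℕ} (i : Fin m) (x : Word (m + 1)) : Word (m + 1) :=
  fun k => x (Equiv.swap i.castSucc i.succ k)

@[simp] theorem move_castSucc {m : ℕ} (i : Fin m) (x : Word (m + 1)) :
    move i x i.castSucc = x i.succ := by
  simp [move]

@[simp] theorem move_succ {m : ℕ} (i : Fin m) (x : Word (m + 1)) :
    move i x i.succ = x i.castSucc := by
  simp [move]

theorem move_of_ne {m : ℕ} (i : Fin m) (x : Word (m + 1)) {k : Fin (m + 1)}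
    (h1 : k ≠ i.castSucc) (h2 : k ≠ i.succ) : move i x k = x k := by
  simp [move, Equiv.swap_apply_of_ne_of_ne h1 h2]

@[simp] theorem move_move {m : ℕ} (i : Fin m) (x : Word (m + 1)) : move i (move i x) = x := by
  funext k
  simp [move]

theorem ones_move {m : ℕ} (i : Fin m) (x : Word (m + 1)) :
    ones (move i x) = (ones x).map (Equiv.swap i.castSucc i.succ).toEmbedding := by
  ext k
  rw [mem_map_equiv, mem_ones, mem_ones, Equiv.symm_swap]
  rfl

theorem weight_move {m : ℕ} (i : Fin m) (x : Word (m + 1)) : weight (move i x) = weight x := by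
  simp [weight, ones_move]

/-- The elementary shift of a one from position `i` to a zero at position `i + 1` preserves the
order of the ones, so it moves exactly one entry of the position sequence. -/
theorem pos_move {m w : ℕ} {i : Fin m} {x : Word (m + 1)} (hx : weight x = w)
    (hx' : weight (move i x) = w) (h0 : x i.succ = false) (k : Fin w) :
    pos (move i x) hx' k = Equiv.swap i.castSucc i.succ (pos x hx k) := by
  have hmem : ∀ k, pos x hx k ∈ ones x := fun k => Finset.orderEmbOfFin_mem _ hx k
  have hne : ∀ k, pos x hx k ≠ i.succ := by
    intro k hk
    have := hmem k
    rw [hk, mem_ones, h0] at this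
    exact absurd this (by simp)
  have hval : ∀ k, ((Equiv.swap i.castSucc i.succ (pos x hx k) : Fin (m + 1)) : ℕ)
      = if (pos x hx k : ℕ) = i then (i : ℕ) + 1 else pos x hx k := by
    intro k
    split_ifs with h
    · rw [show pos x hx k = i.castSucc from Fin.ext h, Equiv.swap_apply_left, Fin.val_succ]
    · rw [Equiv.swap_apply_of_ne_of_ne (fun h' => h (by rw [h']; rfl)) (hne k)]
  have huniq := Finset.orderEmbOfFin_unique (s := ones (move i x)) hx'
    (f := fun k => Equiv.swap i.castSucc i.succ (pos x hx k)) ?_ ?_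
  · exact (congrFun huniq k).symm
  · intro k
    rw [ones_move]
    exact mem_map_of_mem _ (hmem k)
  · intro a b hab
    have h1 : (pos x hx a : ℕ) < pos x hx b := (pos x hx).strictMono hab
    have h2 : (pos x hx b : ℕ) ≠ i + 1 := fun h => hne b (Fin.ext (by simpa using h))
    rw [Fin.lt_def, hval, hval]
    split_ifs <;> omega

theorem rightShift_move {m : ℕ} {i : Fin m} {x : Word (m + 1)}
    (h1 : x i.castSucc = true) (h0 : x i.succ = false) :
    RightShift x (move i x) ∧ rank (move i x) = rank x + 1 := by
  have hw := weight_move i x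
  have key : ∀ k ∈ ones x, ((Equiv.swap i.castSucc i.succ k : Fin (m + 1)) : ℕ)
      = k + if k = i.castSucc then 1 else 0 := by
    intro k hk
    split_ifs with h
    · rw [h, Equiv.swap_apply_left]
      simp
    · rw [Equiv.swap_apply_of_ne_of_ne h, add_zero]
      rintro rfl
      rw [mem_ones, h0] at hk
      exact absurd hk (by simp)
  constructor
  · rw [rightShift_iff rfl hw]
    intro k
    have hk : pos x rfl k ∈ ones x := Finset.orderEmbOfFin_mem _ rfl k
    rw [pos_move rfl hw h0, Fin.le_def, key _ hk]
    exact Nat.le_add_right _ _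
  · have h2 := rank_add hw
    have h3 := rank_add (rfl : weight x = weight x)
    rw [ones_move, sum_map] at h2
    simp only [Equiv.coe_toEmbedding] at h2
    rw [sum_congr rfl key, sum_add_distrib, sum_ite_eq', if_pos (mem_ones.2 h1)] at h2
    omega

/-! ### The raising and lowering operators -/

/-- The square root of `(i + 1) (m - i)`, the weight of the elementary shift between positions `i`
and `i + 1`. These are the matrix entries of the irreducible representation of `sl₂` of dimension
`m + 1` in an orthonormal basis. -/
noncomputable def coef {m : ℕ} (i : Fin m) : ℝ := √(((i : ℝ) + 1) * (m - i))

theorem coef_mul_self {m : ℕ} (i : Fin m) : coef i * coef i = ((i : ℝ) + 1) * (m - i) := by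
  have : (i : ℝ) ≤ m := by exact_mod_cast i.2.le
  exact Real.mul_self_sqrt (mul_nonneg (by positivity) (by linarith))

/-- The weighted sum of all elementary shifts: for `b = false` it carries the indicator function
of a word to words one rank higher, for `b = true` to words one rank lower. -/
noncomputable def shiftOp {m : ℕ} (b : Bool) : (Word (m + 1) → ℝ) →ₗ[ℝ] (Word (m + 1) → ℝ) where
  toFun f y := ∑ i : Fin m,
    if y i.castSucc = b ∧ y i.succ = !b then coef i * f (move i y) else 0
  map_add' f g := by
    funext y
    simp only [Pi.add_apply, ← sum_add_distrib]
    refine sum_congr rfl fun i _ => ?_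
    split_ifs <;> ring
  map_smul' c f := by
    funext y
    simp only [Pi.smul_apply, smul_eq_mul, RingHom.id_apply, mul_sum]
    refine sum_congr rfl fun i _ => ?_
    split_ifs <;> ring

theorem shiftOp_apply {m : ℕ} (b : Bool) (f : Word (m + 1) → ℝ) (y : Word (m + 1)) :
    shiftOp b f y = ∑ i : Fin m,
      if y i.castSucc = b ∧ y i.succ = !b then coef i * f (move i y) else 0 := rfl

/-- The raising and lowering operators are adjoint to each other. -/
theorem sum_shiftOp_mul {m : ℕ} (b : Bool) (f g : Word (m + 1) → ℝ) :
    ∑ y, shiftOp b f y * g y = ∑ y, f y * shiftOp (!b) g y := by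
  simp only [shiftOp_apply, sum_mul, mul_sum]
  rw [sum_comm, sum_comm (s := (univ : Finset (Word (m + 1))))]
  refine sum_congr rfl fun i _ => ?_
  have hinv : Function.Involutive (move i) := move_move i
  refine Fintype.sum_bijective (move i) hinv.bijective _ _ fun y => ?_
  rw [move_castSucc, move_succ, move_move, Bool.not_not]
  by_cases h : y i.castSucc = b ∧ y i.succ = !b
  · rw [if_pos h, if_pos h.symm]
    ring
  · rw [if_neg h, if_neg fun h' => h h'.symm]
    ring

/-- Shifting one pair of letters up and another one down can be done in either order. -/
theorem move_comm_term {m : ℕ} (f : Word (m + 1) → ℝ) (x : Word (m + 1)) {i j : Fin m}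
    (hij : i ≠ j) :
    (if x i.castSucc = true ∧ x i.succ = false then coef i *
      (if move i x j.castSucc = false ∧ move i x j.succ = true then
        coef j * f (move j (move i x)) else 0) else 0) =
    (if x j.castSucc = false ∧ x j.succ = true then coef j *
      (if move j x i.castSucc = true ∧ move j x i.succ = false then
        coef i * f (move i (move j x)) else 0) else 0) := by
  have hij' : (i : ℕ) ≠ j := fun h => hij (Fin.ext h)
  by_cases h1 : (j : ℕ) = i + 1
  · -- Overlapping pairs: the letter between them blocks both orders.
    have e : j.castSucc = i.succ := Fin.ext (by simpa using h1)
    have a1 : move i x j.castSucc = x i.castSucc := by rw [e, move_succ]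
    have a2 : move j x i.succ = x j.succ := by rw [← e, move_castSucc]
    rw [a1, a2]
    cases x i.castSucc <;> cases x j.succ <;> simp
  by_cases h2 : (i : ℕ) = j + 1
  · have e : i.castSucc = j.succ := Fin.ext (by simpa using h2)
    have a1 : move i x j.succ = x i.succ := by rw [← e, move_castSucc]
    have a2 : move j x i.castSucc = x j.castSucc := by rw [e, move_succ]
    rw [a1, a2]
    cases x i.succ <;> cases x j.castSucc <;> simp
  have e1 : j.castSucc ≠ i.castSucc := by rw [Ne, Fin.ext_iff]; simp; omega
  have e2 : j.castSucc ≠ i.succ := by rw [Ne, Fin.ext_iff]; simp; omega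
  have e3 : j.succ ≠ i.castSucc := by rw [Ne, Fin.ext_iff]; simp; omega
  have e4 : j.succ ≠ i.succ := by rw [Ne, Fin.ext_iff]; simp; omega
  have hcomm : move j (move i x) = move i (move j x) := by
    funext k
    by_cases hk1 : k = i.castSucc
    · subst hk1
      rw [move_of_ne j _ e1.symm e3.symm, move_castSucc, move_castSucc,
        move_of_ne j _ e2.symm e4.symm]
    by_cases hk2 : k = i.succ
    · subst hk2
      rw [move_of_ne j _ e2.symm e4.symm, move_succ, move_succ, move_of_ne j _ e1.symm e3.symm]
    rw [move_of_ne i _ hk1 hk2]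
    by_cases hk3 : k = j.castSucc
    · subst hk3
      rw [move_castSucc, move_castSucc, move_of_ne i _ e3 e4]
    by_cases hk4 : k = j.succ
    · subst hk4
      rw [move_succ, move_succ, move_of_ne i _ e1 e2]
    rw [move_of_ne j _ hk3 hk4, move_of_ne j _ hk3 hk4, move_of_ne i _ hk1 hk2]
  rw [move_of_ne i _ e1 e2, move_of_ne i _ e3 e4, move_of_ne j _ e1.symm e3.symm,
    move_of_ne j _ e2.symm e4.symm, hcomm]
  split_ifs <;> ring

/-- The diagonal entry of the commutator: a one at position `k` contributes the difference `m - 2 k`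
of the consecutive values `(k + 1) (m - k)` and `k (m + 1 - k)` of `coef ^ 2`. -/
theorem sum_coef_diag {m : ℕ} (x : Word (m + 1)) :
    ∑ i : Fin m, ((if x i.castSucc = true ∧ x i.succ = false then coef i * coef i else 0)
      - (if x i.castSucc = false ∧ x i.succ = true then coef i * coef i else 0))
      = (weight x : ℝ) * (m + 1 - weight x) - 2 * rank x := by
  set u : Fin (m + 1) → ℝ := fun k => if x k = true then 1 else 0 with hu
  have h1 : ∀ i : Fin m,
      ((if x i.castSucc = true ∧ x i.succ = false then coef i * coef i else 0)
        - (if x i.castSucc = false ∧ x i.succ = true then coef i * coef i else 0))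
      = u i.castSucc * (((i : ℝ) + 1) * (m - i)) - u i.succ * (((i : ℝ) + 1) * (m - i)) := by
    intro i
    rw [coef_mul_self]
    simp only [hu]
    cases x i.castSucc <;> cases x i.succ <;> simp
  -- Summation by parts.
  have h2 : ∑ k, u k * (((k : ℝ) + 1) * (m - k))
      = ∑ i : Fin m, u i.castSucc * (((i : ℝ) + 1) * (m - i)) := by
    rw [Fin.sum_univ_castSucc]
    simp
  have h3 : ∑ k, u k * ((k : ℝ) * (m + 1 - k))
      = ∑ i : Fin m, u i.succ * (((i : ℝ) + 1) * (m - i)) := by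
    rw [Fin.sum_univ_succ]
    simp
  have h4 : ∀ g : Fin (m + 1) → ℝ, ∑ k, u k * g k = ∑ k ∈ ones x, g k := by
    intro g
    rw [ones, sum_filter]
    exact sum_congr rfl fun k _ => by simp [hu]
  have h5 := two_mul_rank_add (rfl : weight x = weight x)
  have h6 : ∑ k ∈ ones x, ((m : ℝ) - 2 * k) = weight x * m - 2 * ∑ k ∈ ones x, (k : ℝ) := by
    rw [sum_sub_distrib, sum_const, nsmul_eq_mul, mul_sum]
    rfl
  rw [sum_congr rfl fun i _ => h1 i, sum_sub_distrib, ← h2, ← h3, h4, h4, ← sum_sub_distrib]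
  have h7 : ∀ k : Fin (m + 1), ((k : ℝ) + 1) * (m - k) - (k : ℝ) * (m + 1 - k) = m - 2 * k :=
    fun k => by ring
  rw [sum_congr rfl fun k _ => h7 k, h6]
  linarith

/-- The `sl₂` relation: the commutator of the two operators is diagonal, with eigenvalue
`w (n - w) - 2 rank x` at a word `x` of length `n` and weight `w`. -/
theorem shiftOp_commutator {m : ℕ} (f : Word (m + 1) → ℝ) (x : Word (m + 1)) :
    shiftOp true (shiftOp false f) x = shiftOp false (shiftOp true f) x
      + ((weight x : ℝ) * (m + 1 - weight x) - 2 * rank x) * f x := by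
  have key : ∀ i j : Fin m,
      (if x i.castSucc = true ∧ x i.succ = false then coef i *
        (if move i x j.castSucc = false ∧ move i x j.succ = true then
          coef j * f (move j (move i x)) else 0) else 0) =
      (if x j.castSucc = false ∧ x j.succ = true then coef j *
        (if move j x i.castSucc = true ∧ move j x i.succ = false then
          coef i * f (move i (move j x)) else 0) else 0)
      + if i = j then
        ((if x i.castSucc = true ∧ x i.succ = false then coef i * coef i else 0)
        - (if x i.castSucc = false ∧ x i.succ = true then coef i * coef i else 0)) * f x
        else 0 := by
    intro i j
    by_cases hij : i = j
    · subst hij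
      simp only [move_castSucc, move_succ, move_move, if_true]
      cases x i.castSucc <;> cases x i.succ <;> simp <;> ring
    · rw [if_neg hij, add_zero, move_comm_term f x hij]
  have hl : ∀ b c : Bool, c = !b → shiftOp b (shiftOp c f) x = ∑ i : Fin m, ∑ j : Fin m,
      (if x i.castSucc = b ∧ x i.succ = c then coef i *
        (if move i x j.castSucc = c ∧ move i x j.succ = b then
          coef j * f (move j (move i x)) else 0) else 0) := by
    rintro b c rfl
    rw [shiftOp_apply]
    refine sum_congr rfl fun i _ => ?_
    rw [shiftOp_apply, Bool.not_not]
    split_ifs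
    · rw [mul_sum]
    · simp
  rw [hl true false rfl, hl false true rfl,
    sum_congr rfl fun i _ => sum_congr rfl fun j _ => key i j]
  simp only [sum_add_distrib, sum_ite_eq, mem_univ, if_true, ← sum_mul, sum_coef_diag]
  rw [sum_comm]

/-- The commutator relation in the form of an identity between squared norms. -/
theorem norm_shiftOp {m : ℕ} (f : Word (m + 1) → ℝ) :
    ∑ x, shiftOp false f x * shiftOp false f x = ∑ x, shiftOp true f x * shiftOp true f x
      + ∑ x, ((weight x : ℝ) * (m + 1 - weight x) - 2 * rank x) * (f x * f x) := by
  rw [sum_shiftOp_mul, sum_shiftOp_mul, ← sum_add_distrib]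
  refine sum_congr rfl fun x _ => ?_
  rw [Bool.not_false, Bool.not_true, shiftOp_commutator]
  ring

/-! ### Expansion of levels -/

/-- If `shiftOp b` is injective on the functions supported on `S`, then the set of words
reached from `S` by an elementary shift in its direction is at least as large as `S`. -/
theorem exists_card_le_of_injective {m : ℕ} (b : Bool) (S : Finset (Word (m + 1)))
    (hinj : ∀ f : Word (m + 1) → ℝ, (∀ x ∉ S, f x = 0) → shiftOp b f = 0 → f = 0) :
    ∃ T : Finset (Word (m + 1)), S.card ≤ T.card ∧
      ∀ y ∈ T, ∃ i : Fin m, y i.castSucc = b ∧ y i.succ = (!b) ∧ move i y ∈ S := by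
  classical
  let T : Finset (Word (m + 1)) :=
    univ.filter fun y => ∃ i : Fin m, y i.castSucc = b ∧ y i.succ = (!b) ∧ move i y ∈ S
  refine ⟨T, ?_, fun y hy => (mem_filter.1 hy).2⟩
  let ext : (S → ℝ) →ₗ[ℝ] (Word (m + 1) → ℝ) :=
    { toFun := fun g x => if h : x ∈ S then g ⟨x, h⟩ else 0
      map_add' := fun g g' => by
        funext x
        by_cases h : x ∈ S <;> simp [h]
      map_smul' := fun c g => by
        funext x
        by_cases h : x ∈ S <;> simp [h] }
  let φ : (S → ℝ) →ₗ[ℝ] (T → ℝ) := (LinearMap.funLeft ℝ ℝ (Subtype.val)) ∘ₗ shiftOp b ∘ₗ ext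
  have hφ : Function.Injective φ := by
    rw [injective_iff_map_eq_zero]
    intro g hg
    have h0 : ext g = 0 := by
      refine hinj _ (fun x hx => dif_neg hx) ?_
      funext y
      by_cases hy : y ∈ T
      · exact congrFun hg ⟨y, hy⟩
      · rw [shiftOp_apply]
        refine sum_eq_zero fun i _ => ?_
        split_ifs with h
        · have : move i y ∉ S := fun hS => hy (mem_filter.2 ⟨mem_univ _, i, h.1, h.2, hS⟩)
          rw [show ext g (move i y) = 0 from dif_neg this, mul_zero]
        · rfl
    funext s
    have := congrFun h0 s.1
    rwa [show ext g s.1 = g s from dif_pos s.2] at this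
  simpa using LinearMap.finrank_le_finrank_of_injective hφ

theorem eq_zero_of_sum_mul_nonpos {X : Type*} [Fintype X] {c f : X → ℝ}
    (hc : ∀ x, f x ≠ 0 → 0 < c x) (h : ∑ x, c x * (f x * f x) ≤ 0) : f = 0 := by
  have hnn : ∀ x ∈ univ, 0 ≤ c x * (f x * f x) := by
    intro x _
    by_cases hx : f x = 0
    · simp [hx]
    · exact mul_nonneg (hc x hx).le (mul_self_nonneg _)
  have h0 := (sum_eq_zero_iff_of_nonneg hnn).1 (le_antisymm h (sum_nonneg hnn))
  funext x
  by_contra hx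
  exact (mul_pos (hc x hx) (mul_self_pos.2 hx)).ne' (h0 x (mem_univ x))

theorem cast_level {m : ℕ} (x : Word (m + 1)) :
    ((weight x * (m + 1 - weight x) : ℕ) : ℝ) = (weight x : ℝ) * (m + 1 - weight x) := by
  rw [Nat.cast_mul, Nat.cast_sub (weight_le x)]
  push_cast
  rfl

theorem rank_eq_zero_of_length_zero (x : Word 0) : rank x = 0 := by
  have h : weight x = 0 := Nat.le_zero.1 (weight_le x)
  rw [rank_eq_sum h]
  rfl

/-- Strictly below the middle rank, every set of words has at least as many upper covers as
elements. -/
theorem exists_upper_covers {n : ℕ} (S : Finset (Word n))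
    (hS : ∀ x ∈ S, 2 * rank x < weight x * (n - weight x)) :
    ∃ T : Finset (Word n), S.card ≤ T.card ∧
      ∀ y ∈ T, ∃ x ∈ S, RightShift x y ∧ rank y = rank x + 1 := by
  cases n with
  | zero =>
    refine ⟨∅, ?_, by simp⟩
    rw [eq_empty_of_forall_notMem (s := S) fun x hx => by simpa using hS x hx]
  | succ m =>
    have hinj : ∀ f : Word (m + 1) → ℝ, (∀ x ∉ S, f x = 0) → shiftOp false f = 0 → f = 0 := by
      intro f hf h0
      refine eq_zero_of_sum_mul_nonpos
        (c := fun x => (weight x : ℝ) * (m + 1 - weight x) - 2 * rank x) ?_ ?_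
      · intro x hx
        have hlt := hS x (by by_contra h; exact hx (hf x h))
        rw [← cast_level, sub_pos]
        exact_mod_cast hlt
      · have hn := norm_shiftOp f
        have hnn : 0 ≤ ∑ x, shiftOp true f x * shiftOp true f x :=
          sum_nonneg fun x _ => mul_self_nonneg _
        simp only [h0, Pi.zero_apply, mul_zero, sum_const_zero] at hn
        linarith
    obtain ⟨T, hT, h⟩ := exists_card_le_of_injective false S hinj
    refine ⟨T, hT, fun y hy => ?_⟩
    obtain ⟨i, h0, h1, hi⟩ := h y hy
    refine ⟨_, hi, ?_⟩
    have := rightShift_move (i := i) (x := move i y) (by simpa using h1) (by simpa using h0)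
    rwa [move_move] at this

/-- Strictly above the middle rank, every set of words has at least as many lower covers as
elements. -/
theorem exists_lower_covers {n : ℕ} (S : Finset (Word n))
    (hS : ∀ x ∈ S, weight x * (n - weight x) < 2 * rank x) :
    ∃ T : Finset (Word n), S.card ≤ T.card ∧
      ∀ y ∈ T, ∃ x ∈ S, RightShift y x ∧ rank x = rank y + 1 := by
  cases n with
  | zero =>
    refine ⟨∅, ?_, by simp⟩
    rw [eq_empty_of_forall_notMem (s := S) fun x hx => by
      simpa [rank_eq_zero_of_length_zero] using hS x hx]
  | succ m =>
    have hinj : ∀ f : Word (m + 1) → ℝ, (∀ x ∉ S, f x = 0) → shiftOp true f = 0 → f = 0 := by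
      intro f hf h0
      refine eq_zero_of_sum_mul_nonpos
        (c := fun x => 2 * rank x - (weight x : ℝ) * (m + 1 - weight x)) ?_ ?_
      · intro x hx
        have hlt := hS x (by by_contra h; exact hx (hf x h))
        rw [← cast_level, sub_pos]
        exact_mod_cast hlt
      · have hn := norm_shiftOp f
        have hnn : 0 ≤ ∑ x, shiftOp false f x * shiftOp false f x :=
          sum_nonneg fun x _ => mul_self_nonneg _
        simp only [h0, Pi.zero_apply, mul_zero, sum_const_zero, zero_add] at hn
        rw [hn] at hnn
        rw [← neg_nonneg, ← sum_neg_distrib]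
        exact hnn.trans_eq (sum_congr rfl fun x _ => by ring)
    obtain ⟨T, hT, h⟩ := exists_card_le_of_injective true S hinj
    refine ⟨T, hT, fun y hy => ?_⟩
    obtain ⟨i, h0, h1, hi⟩ := h y hy
    exact ⟨_, hi, rightShift_move h0 h1⟩

/-! ### Pushing antichains -/

/-- An antichain can be pushed up to level `m`, without losing elements, if every set inside a
level below `m` has at least as many successors in the next level: replace the lowest level of the
antichain by its successors. -/
theorem exists_antichain_ge {X : Type*} {R : X → X → Prop}
    (htrans : ∀ x y z, R x y → R y z → R x z) (d : X → ℤ) (hd : ∀ x y, R x y → d x < d y)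
    (P : X → Prop) (m : ℤ)
    (hexp : ∀ r < m, ∀ S : Finset X, (∀ s ∈ S, P s ∧ d s = r) →
      ∃ T : Finset X, S.card ≤ T.card ∧ ∀ t ∈ T, P t ∧ d t = r + 1 ∧ ∃ s ∈ S, R s t)
    (A : Finset X) (hP : ∀ x ∈ A, P x) (hA : ∀ x ∈ A, ∀ y ∈ A, ¬ R x y) :
    ∃ B : Finset X, A.card ≤ B.card ∧ (∀ x ∈ B, P x) ∧ (∀ x ∈ B, ∀ y ∈ B, ¬ R x y) ∧
      ∀ b ∈ B, m ≤ d b ∧ (b ∈ A ∨ d b = m) := by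
  classical
  have key : ∀ k : ℕ, ∀ A : Finset X, (∀ x ∈ A, P x) → (∀ x ∈ A, ∀ y ∈ A, ¬ R x y) →
      (∀ a ∈ A, m - k ≤ d a) →
      ∃ B : Finset X, A.card ≤ B.card ∧ (∀ x ∈ B, P x) ∧ (∀ x ∈ B, ∀ y ∈ B, ¬ R x y) ∧
        ∀ b ∈ B, m ≤ d b ∧ (b ∈ A ∨ d b = m) := by
    intro k
    induction k with
    | zero =>
      intro A hP hA hk
      exact ⟨A, le_rfl, hP, hA, fun b hb => ⟨by simpa using hk b hb, Or.inl hb⟩⟩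
    | succ k ih =>
      intro A hP hA hk
      push_cast at hk
      obtain ⟨T, hT, hT'⟩ := hexp (m - (k + 1)) (by omega)
        (A.filter fun a => d a = m - (k + 1)) fun s hs => by
          rw [mem_filter] at hs
          exact ⟨hP s hs.1, hs.2⟩
      have hTd : ∀ t ∈ T, d t = m - k := fun t ht => by
        have := (hT' t ht).2.1
        omega
      have hTA : ∀ t ∈ T, ∃ s ∈ A, R s t := fun t ht => by
        obtain ⟨s, hs, hst⟩ := (hT' t ht).2.2
        exact ⟨s, (mem_filter.1 hs).1, hst⟩
      have hUd : ∀ a ∈ A.filter (fun a => ¬ d a = m - (k + 1)), a ∈ A ∧ m - k ≤ d a := by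
        intro a ha
        rw [mem_filter] at ha
        have := hk a ha.1
        exact ⟨ha.1, by omega⟩
      have hdisj : Disjoint (A.filter fun a => ¬ d a = m - (k + 1)) T := by
        rw [disjoint_left]
        intro t ht htT
        obtain ⟨s, hs, hst⟩ := hTA t htT
        exact hA s hs t (hUd t ht).1 hst
      set U := (A.filter fun a => ¬ d a = m - (k + 1)) ∪ T with hU
      have hUP : ∀ x ∈ U, P x := by
        intro x hx
        rcases mem_union.1 hx with h | h
        · exact hP x (hUd x h).1
        · exact (hT' x h).1
      have hUA : ∀ x ∈ U, ∀ y ∈ U, ¬ R x y := by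
        intro x hx y hy hxy
        have hlt := hd x y hxy
        rcases mem_union.1 hy with h' | h'
        · rcases mem_union.1 hx with h | h
          · exact hA x (hUd x h).1 y (hUd y h').1 hxy
          · obtain ⟨s, hs, hsx⟩ := hTA x h
            exact hA s hs y (hUd y h').1 (htrans _ _ _ hsx hxy)
        · have h2 := hTd y h'
          rcases mem_union.1 hx with h | h
          · have := (hUd x h).2
            omega
          · have := hTd x h
            omega
      have hUm : ∀ a ∈ U, m - k ≤ d a := by
        intro a ha
        rcases mem_union.1 ha with h | h
        · exact (hUd a h).2
        · exact (hTd a h).ge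
      obtain ⟨B, hB, hBP, hBA, hBm⟩ := ih U hUP hUA hUm
      refine ⟨B, ?_, hBP, hBA, fun b hb => ⟨(hBm b hb).1, ?_⟩⟩
      · rw [hU, card_union_of_disjoint hdisj] at hB
        have := card_filter_add_card_filter_not (s := A) (fun a => d a = m - (k + 1))
        omega
      · have hmb := (hBm b hb).1
        rcases (hBm b hb).2 with h | h
        · rcases mem_union.1 h with h | h
          · exact Or.inl (hUd b h).1
          · have := hTd b h
            exact Or.inr (by omega)
        · exact Or.inr h
  refine key (∑ a ∈ A, (m - d a).toNat) A hP hA fun a ha => ?_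
  have h1 : (m - d a).toNat ≤ ∑ a ∈ A, (m - d a).toNat :=
    single_le_sum (f := fun a => (m - d a).toNat) (fun _ _ => Nat.zero_le _) ha
  omega

/-! ### Levels and partitions in a box -/

/-- The sequence `lamTilde x` of a word of weight `w`, indexed by `Fin w`. -/
def shape {n w : ℕ} (x : Word n) (hx : weight x = w) (i : Fin w) : ℕ :=
  lamTilde x (Fin.cast hx.symm i)

theorem shape_monotone {n w : ℕ} (x : Word n) (hx : weight x = w) : Monotone (shape x hx) := by
  cases w with
  | zero => exact fun i => i.elim0
  | succ v =>
    rw [Fin.monotone_iff_le_succ]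
    intro i
    have h1 := lamTilde_cast x hx i.castSucc
    have h2 := lamTilde_cast x hx i.succ
    have h3 : (pos x hx i.castSucc : ℕ) < pos x hx i.succ :=
      (pos x hx).strictMono Fin.castSucc_lt_succ
    simp only [Fin.val_castSucc, Fin.val_succ] at h1 h2
    unfold shape
    omega

theorem shape_le {n w : ℕ} (x : Word n) (hx : weight x = w) (i : Fin w) :
    shape x hx i ≤ n - w := by
  cases w with
  | zero => exact i.elim0
  | succ v =>
    have h1 := shape_monotone x hx (Fin.le_last i)
    have h2 := lamTilde_cast x hx (Fin.last v)
    have h3 := (pos x hx (Fin.last v)).isLt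
    rw [Fin.val_last] at h2
    unfold shape at h1 ⊢
    omega

theorem shape_injective {n w : ℕ} {x y : Word n} (hx : weight x = w) (hy : weight y = w)
    (h : shape x hx = shape y hy) : x = y := by
  refine ext_pos hx hy fun i => Fin.ext ?_
  rw [← lamTilde_cast, ← lamTilde_cast]
  exact congrArg (· + (i : ℕ)) (congrFun h i)

/-- Adding `(0, 1, …, w - 1)` to a weakly increasing sequence gives the positions of the ones of
a word. -/
theorem exists_shape_eq {n w : ℕ} (hw : w ≤ n) (f : Fin w → ℕ) (hf : Monotone f)
    (hle : ∀ i, f i ≤ n - w) : ∃ (x : Word n) (hx : weight x = w), shape x hx = f := by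
  let g : Fin w → Fin n := fun i => ⟨f i + i, by have := hle i; omega⟩
  have hg : StrictMono g := fun i j hij => by
    have := hf hij.le
    simp only [g, Fin.lt_def] at hij ⊢
    omega
  let x : Word n := fun k => decide (∃ i, g i = k)
  have hmem : ∀ k, k ∈ ones x ↔ ∃ i, g i = k := fun k => by simp [mem_ones, x]
  have hones : ones x = univ.map ⟨g, hg.injective⟩ := by
    ext k
    simp [hmem]
  have hx : weight x = w := by simp [weight, hones]
  refine ⟨x, hx, funext fun i => ?_⟩
  have h1 : g = pos x hx := Finset.orderEmbOfFin_unique hx (fun i => (hmem _).2 ⟨i, rfl⟩) hg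
  have h2 := lamTilde_cast x hx i
  rw [← h1] at h2
  exact Nat.add_right_cancel h2

/-- The multiset of values of a shape, with zeros. -/
def shapeParts {n w : ℕ} (x : Word n) (hx : weight x = w) : Multiset ℕ :=
  (List.ofFn (shape x hx) : Multiset ℕ)

theorem sum_shapeParts {n w : ℕ} (x : Word n) (hx : weight x = w) :
    (shapeParts x hx).sum = rank x := by
  rw [shapeParts, Multiset.sum_coe, List.sum_ofFn, rank_eq_sum hx]
  rfl

theorem card_shapeParts {n w : ℕ} (x : Word n) (hx : weight x = w) :
    (shapeParts x hx).card = w := by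
  simp [shapeParts]

theorem eq_of_filter_ne_zero_eq {s t : Multiset ℕ} (hc : s.card = t.card)
    (h : s.filter (· ≠ 0) = t.filter (· ≠ 0)) : s = t := by
  have key : ∀ u : Multiset ℕ, u = u.filter (· ≠ 0) +
      Multiset.replicate (u.card - (u.filter (· ≠ 0)).card) 0 := by
    intro u
    have h1 := Multiset.filter_add_not (· ≠ 0) u
    have h2 : u.filter (fun a => ¬ a ≠ 0) =
        Multiset.replicate (u.filter (fun a => ¬ a ≠ 0)).card 0 :=
      Multiset.eq_replicate_card.2 fun a ha => by simpa using (Multiset.mem_filter.1 ha).2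
    have h3 := congrArg Multiset.card h1
    rw [Multiset.card_add] at h3
    rw [← h3, Nat.add_sub_cancel_left, ← h2, h1]
  rw [key s, key t, h, hc]

/-- The words of weight `w` and rank `l` correspond to the partitions of `l` in a box: the parts are
the nonzero terms of the shape. -/
theorem card_level {n w : ℕ} (hw : w ≤ n) (l : ℕ) :
    (univ.filter fun x : Word n => weight x = w ∧ rank x = l).card = p (n - w) w l := by
  have hmem : ∀ x : Word n, x ∈ univ.filter (fun x : Word n => weight x = w ∧ rank x = l) →
      weight x = w ∧ rank x = l := fun x hx => (mem_filter.1 hx).2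
  refine Finset.card_bij (fun x hx => Nat.Partition.ofSums l (shapeParts x (hmem x hx).1)
    ((sum_shapeParts x _).trans (hmem x hx).2)) ?_ ?_ ?_
  · intro x hx
    refine mem_filter.2 ⟨mem_univ _, ?_, ?_⟩
    · exact (Multiset.card_le_card (Multiset.filter_le _ _)).trans (card_shapeParts x _).le
    · intro a ha
      have ha' : a ∈ shapeParts x (hmem x hx).1 := (Multiset.mem_filter.1 ha).1
      rw [shapeParts, Multiset.mem_coe, List.mem_ofFn] at ha'
      obtain ⟨i, rfl⟩ := ha'
      exact shape_le x _ i
  · intro x hx y hy h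
    have h1 : shapeParts x (hmem x hx).1 = shapeParts y (hmem y hy).1 :=
      eq_of_filter_ne_zero_eq (by rw [card_shapeParts, card_shapeParts])
        (congrArg Nat.Partition.parts h)
    have h2 := List.Perm.eq_of_sortedLE (shape_monotone x _).sortedLE_ofFn
      (shape_monotone y _).sortedLE_ofFn (Multiset.coe_eq_coe.1 h1)
    exact shape_injective _ _ (List.ofFn_injective h2)
  · intro q hq
    obtain ⟨-, hc, hle⟩ := mem_filter.1 hq
    set s : Multiset ℕ := q.parts + Multiset.replicate (w - q.parts.card) 0 with hs
    have hcard : s.card = w := by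
      rw [hs, Multiset.card_add, Multiset.card_replicate]
      omega
    have hlen : (s.sort (· ≤ ·)).length = w := by rw [Multiset.length_sort, hcard]
    let f : Fin w → ℕ := fun i => (s.sort (· ≤ ·)).get (i.cast hlen.symm)
    have hofFn : List.ofFn f = s.sort (· ≤ ·) := by
      rw [← List.ofFn_congr hlen, List.ofFn_get]
    have hmono : Monotone f := by
      rw [← List.sortedLE_ofFn_iff, hofFn]
      exact (Multiset.pairwise_sort s _).sortedLE
    have hfle : ∀ i, f i ≤ n - w := by
      intro i
      have h1 : f i ∈ s := (Multiset.mem_sort (· ≤ ·)).1 (List.get_mem _ _)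
      rcases Multiset.mem_add.1 h1 with h | h
      · exact hle _ h
      · rw [Multiset.eq_of_mem_replicate h]
        exact Nat.zero_le _
    obtain ⟨x, hx, hxf⟩ := exists_shape_eq hw f hmono hfle
    have hparts : shapeParts x hx = s := by
      rw [shapeParts, hxf, hofFn, Multiset.sort_eq]
    have hrank : rank x = l := by
      rw [← sum_shapeParts x hx, hparts, hs, Multiset.sum_add, q.parts_sum]
      simp
    refine ⟨x, mem_filter.2 ⟨mem_univ _, hx, hrank⟩, Nat.Partition.ext ?_⟩
    change (shapeParts x hx).filter (· ≠ 0) = q.parts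
    rw [hparts, hs, Multiset.filter_add, Multiset.filter_eq_self.2 fun a ha => (q.parts_pos ha).ne',
      Multiset.filter_eq_nil.2 fun a ha => by simp [Multiset.eq_of_mem_replicate ha]]
    exact add_zero _

/-! ### Codes -/

/-- A code detecting all patterns of right-shifts is an antichain; pushed to the middle level from
below and then from above, it loses no elements. -/
theorem card_le_of_detectsAll {n w : ℕ} (hw : w ≤ n) {C : Finset (Word n)}
    (hC : ∀ x ∈ C, weight x = w) (hdet : AsymmetricChannel.DetectsAll RightShift C) :
    C.card ≤ p (n - w) w (w * (n - w) / 2) := by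
  let R : Word n → Word n → Prop := fun x y => RightShift x y ∧ x ≠ y
  have hlt : ∀ x y, R x y → rank x < rank y := fun x y h => h.1.rank_lt h.2
  have htrans : ∀ x y z, R x y → R y z → R x z := by
    rintro x y z hxy hyz
    refine ⟨hxy.1.trans hyz.1, ?_⟩
    rintro rfl
    exact lt_asymm (hlt _ _ hxy) (hlt _ _ hyz)
  obtain ⟨B, hCB, hBw, hBR, hBm⟩ := exists_antichain_ge htrans (fun x => (rank x : ℤ))
    (fun x y h => by exact_mod_cast hlt x y h) (fun x => weight x = w) (w * (n - w) / 2 : ℕ)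
    (by
      intro r hr S hS
      obtain ⟨T, hT, h⟩ := exists_upper_covers S fun x hx => by
        rw [(hS x hx).1]
        have := (hS x hx).2
        omega
      refine ⟨T, hT, fun y hy => ?_⟩
      obtain ⟨x, hx, hxy, hr'⟩ := h y hy
      have hr2 := (hS x hx).2
      refine ⟨hxy.1.symm.trans (hS x hx).1, by omega, x, hx, hxy, ?_⟩
      rintro rfl
      omega) C hC fun x hx y hy h => h.2 (hdet x hx y hy h.1)
  obtain ⟨D, hBD, hDw, -, hDm⟩ := exists_antichain_ge (R := fun x y => R y x)
    (fun x y z h1 h2 => htrans _ _ _ h2 h1) (fun x => -(rank x : ℤ))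
    (fun x y h => by have := hlt y x h; omega) (fun x => weight x = w) (-(w * (n - w) / 2 : ℕ))
    (by
      intro r hr S hS
      obtain ⟨T, hT, h⟩ := exists_lower_covers S fun x hx => by
        rw [(hS x hx).1]
        have := (hS x hx).2
        omega
      refine ⟨T, hT, fun y hy => ?_⟩
      obtain ⟨x, hx, hxy, hr'⟩ := h y hy
      have hr2 := (hS x hx).2
      refine ⟨hxy.1.trans (hS x hx).1, by omega, x, hx, hxy, ?_⟩
      rintro rfl
      omega) B hBw fun x hx y hy => hBR y hy x hx
  rw [← card_level hw]
  refine hCB.trans (hBD.trans (card_le_card fun x hx => mem_filter.2 ⟨mem_univ _, hDw x hx, ?_⟩))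
  obtain ⟨h1, h2 | h2⟩ := hDm x hx
  · have := (hBm x h2).1
    omega
  · omega

theorem detectsAll_level {n : ℕ} (w l : ℕ) : AsymmetricChannel.DetectsAll RightShift
    (univ.filter fun x : Word n => weight x = w ∧ rank x = l) := by
  intro x hx y hy h
  by_contra hne
  have := h.rank_lt hne
  have h1 := (mem_filter.1 hx).2.2
  have h2 := (mem_filter.1 hy).2.2
  omega

theorem detectsUpTo_of_modEq {n t a : ℕ} {C : Finset (Word n)}
    (hC : ∀ x ∈ C, rank x ≡ a [MOD t + 1]) :
    AsymmetricChannel.DetectsUpTo RightShift rank t C := by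
  intro x hx y hy h hne
  have hlt := h.rank_lt hne
  obtain ⟨c, hc⟩ := (Nat.modEq_iff_dvd' hlt.le).1 ((hC x hx).trans (hC y hy).symm)
  have hc0 : 0 < c := Nat.pos_of_ne_zero fun h0 => by
    rw [h0, mul_zero] at hc
    omega
  have := Nat.le_mul_of_pos_right (t + 1) hc0
  rw [abs_sub_comm, abs_of_nonneg (by omega)]
  omega

theorem card_rank_mem {n w : ℕ} (hw : w ≤ n) (L : Finset ℕ) :
    (univ.filter fun x : Word n => weight x = w ∧ rank x ∈ L).card = ∑ l ∈ L, p (n - w) w l := by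
  rw [Finset.card_eq_sum_card_fiberwise (f := rank) (t := L)
    fun x hx => (mem_filter.1 (mem_coe.1 hx)).2.2]
  refine sum_congr rfl fun l hl => ?_
  rw [← card_level hw]
  refine congrArg Finset.card (Finset.ext fun x => ?_)
  simp only [mem_filter, mem_univ, true_and]
  constructor
  · rintro ⟨⟨h1, -⟩, h2⟩
    exact ⟨h1, h2⟩
  · rintro ⟨h1, h2⟩
    exact ⟨⟨h1, h2 ▸ hl⟩, h2⟩

end BitShift

theorem mainTheorem5 (n w : ℕ) (hw : w ≤ n) :
    (∀ t : ℕ, ∃ m : ℕ,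
      IsGreatest {k : ℕ | ∃ C : Finset (BitShift.Word n), (∀ x ∈ C, BitShift.weight x = w) ∧
        AsymmetricChannel.DetectsUpTo BitShift.RightShift BitShift.rank t C ∧ C.card = k} m ∧
      (∑ l ∈ (Finset.Icc 0 (w * (n - w))).filter
          (fun l => l ≡ w * (n - w) / 2 [MOD t + 1]), BitShift.p (n - w) w l) ≤ m) ∧
    IsGreatest {k : ℕ | ∃ C : Finset (BitShift.Word n), (∀ x ∈ C, BitShift.weight x = w) ∧
        AsymmetricChannel.DetectsAll BitShift.RightShift C ∧ C.card = k}
      (BitShift.p (n - w) w (w * (n - w) / 2)) := by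
  refine ⟨fun t => ?_, ⟨_, fun x hx => (Finset.mem_filter.1 hx).2.1,
    BitShift.detectsAll_level w _, BitShift.card_level hw _⟩, ?_⟩
  · set K := {k : ℕ | ∃ C : Finset (BitShift.Word n), (∀ x ∈ C, BitShift.weight x = w) ∧
        AsymmetricChannel.DetectsUpTo BitShift.RightShift BitShift.rank t C ∧ C.card = k}
    have hbdd : BddAbove K := by
      refine ⟨Fintype.card (BitShift.Word n), ?_⟩
      rintro k ⟨C, -, -, rfl⟩
      exact C.card_le_univ
    set L := (Finset.Icc 0 (w * (n - w))).filter (fun l => l ≡ w * (n - w) / 2 [MOD t + 1]) with hL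
    have hmem : ∑ l ∈ L, BitShift.p (n - w) w l ∈ K := by
      rw [← BitShift.card_rank_mem hw L]
      refine ⟨_, fun x hx => (Finset.mem_filter.1 hx).2.1,
        BitShift.detectsUpTo_of_modEq (a := w * (n - w) / 2) fun x hx => ?_, rfl⟩
      have hx' : BitShift.rank x ∈ L := (Finset.mem_filter.1 hx).2.2
      rw [hL] at hx'
      exact (Finset.mem_filter.1 hx').2
    exact ⟨sSup K, ⟨Nat.sSup_mem ⟨_, hmem⟩ hbdd, fun k hk => le_csSup hbdd hk⟩, le_csSup hbdd hmem⟩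
  · rintro k ⟨C, hC, hdet, rfl⟩
    exact BitShift.card_le_of_detectsAll hw hC hdet
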